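/- Let $n\ge 0$ and $\delta\ge 1$ be integers and let $h_1,\dots,h_{\delta+n}$ be general linear forms on $\mathbb C^{n+1}$, with corresponding hyperplanes $H_i=\{h_i=0\}\subset\mathbb P^n=\mathbb P^n_{\mathbb C}$. Here it suffices that any $n+1$ of the forms are linearly independent, and this condition defines the complement of the zero set of a nonzero polynomial in the coefficients of the $h_i$. Let $Z\subset\mathbb P^n$ be the set of points that lie on at least $n$ of the hyperplanes $H_1,\dots,H_{\delta+n}$; it consists of $\binom{\delta+n}{n}$ points. Then: (1) The linear system of forms of degree $2\delta+1$ on $\mathbb C^{n+1}$ that are singular at every point of $Z$ (the form and all its first partial derivatives vanish there) has the expected codimension in the space of all forms of degree $2\delta+1$, namely $$\min\left(\binom{n+2\delta+1}{n},\,(n+1)\,|Z|\right)=(n+1)\binom{\delta+n}{n}.$$ (2) This linear system is the linear span of the products $h_1^{k_1}\cdots h_{\delta+n}^{k_{\delta+n}}$ with integers $0\le k_i\le 2$, $\sum_i k_i=2\delta+1$, and at least $\delta+2$ of the exponents $k_i$ nonzero. -/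

import Mathlib

open MvPolynomial

/-- Projective space `P^n` over `ℂ`: lines through the origin of `ℂ^(n+1)`. -/
abbrev ProjSpace (n : ℕ) : Type := Projectivization ℂ (Fin (n + 1) → ℂ)

/-- The linear form `∑ j, c j * X j` with coefficient vector `c`. -/
noncomputable def linForm {n : ℕ} (c : Fin (n + 1) → ℂ) : MvPolynomial (Fin (n + 1)) ℂ :=
  ∑ j, C (c j) * X j

/-- The linear forms with coefficient vectors `h i` are in linearly general position:
any `n + 1` of them are linearly independent. -/
def InGeneralPosition {n m : ℕ} (h : Fin m → Fin (n + 1) → ℂ) : Prop :=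
  ∀ S : Finset (Fin m), S.card = n + 1 → LinearIndependent ℂ (fun i : S => h i)

/-- The points of `P^n` that lie on at least `n` of the given hyperplanes `{linForm (h i) = 0}`
(vanishing of a form does not depend on the representative of the point). -/
def starPoints {n m : ℕ} (h : Fin m → Fin (n + 1) → ℂ) : Set (ProjSpace n) :=
  {P | ∃ S : Finset (Fin m), S.card = n ∧ ∀ i ∈ S, eval P.rep (linForm (h i)) = 0}

/-- The hypersurface `f = 0` is singular at `P`: the form `f` and all its first partial
derivatives vanish at `P`. For homogeneous `f` this does not depend on the representative. -/
def SingularAt {n : ℕ} (f : MvPolynomial (Fin (n + 1)) ℂ) (P : ProjSpace n) : Prop :=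
  eval P.rep f = 0 ∧ ∀ j, eval P.rep (pderiv j f) = 0

/-- The linear system of degree `d` hypersurfaces of `P^n` singular at every point of `Z`, as a
subspace of the space of forms of degree `d`. -/
noncomputable def singularSystem {n : ℕ} (d : ℕ) (Z : Set (ProjSpace n)) :
    Submodule ℂ (homogeneousSubmodule (Fin (n + 1)) ℂ d) where
  carrier := {f | ∀ P ∈ Z, SingularAt (f : MvPolynomial (Fin (n + 1)) ℂ) P}
  add_mem' := by
    intro f g hf hg P hP
    refine ⟨?_, fun j => ?_⟩
    · simp [(hf P hP).1, (hg P hP).1]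
    · simp [(hf P hP).2 j, (hg P hP).2 j]
  zero_mem' := by
    intro P _
    simp [SingularAt]
  smul_mem' := by
    intro c f hf P hP
    refine ⟨?_, fun j => ?_⟩
    · simp [smul_eval, (hf P hP).1]
    · simp [smul_eval, (hf P hP).2 j]

/-- The expected codimension, in the space of forms of degree `d` on `P^n`, of the forms that
vanish at `p` points and are singular at `q` further points. -/
def expectedCodim (n d p q : ℕ) : ℕ := min ((n + d).choose n) (p + q * (n + 1))

/-- The product `h_I = ∏ i, (h i) ^ (k i)`, where `k i` is the multiplicity of `i` in the
multi-index `I` (repetitions allowed). -/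
noncomputable def formProduct {n m : ℕ} (h : Fin m → Fin (n + 1) → ℂ) (k : Fin m → ℕ) :
    MvPolynomial (Fin (n + 1)) ℂ :=
  ∏ i, linForm (h i) ^ k i

/-!
Write `m = δ + n` and `h_i` for `linForm (h i)`, with zero set `H_i`. For each set `S` of `n`
indices the hyperplanes `H_i`, `i ∈ S`, meet in one point `P_S` (`starPoint h S`), and general
position says that no other hyperplane contains `P_S`; so the star points are the `m.choose n`
points `P_S`.

Let `g_S = ∏ i ∉ S, h_i`, of degree `δ` (`complProd`), which vanishes at every star point but `P_S`.
For a linear form `l`, the form `g_S ^ 2 * l` has degree `2 * δ + 1` and is singular at all star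
points except possibly `P_S`. Its gradient at `P_S` determines `l`, so the gradients of
`∑ S, g_S ^ 2 * l_S` (`squareSum`) at the star points are arbitrary, and all zero only if every
`l_S` is. This gives the codimension, as a form of positive degree is singular exactly where its
gradient vanishes
(`singularAt_iff_of_isHomogeneous`).

For the span, let `B` be the span of the given products (`manyFactorProducts`). At least two of the
`δ + 2` distinct factors of such a product vanish at `P_S`, so `B` lies in the linear system, and it
suffices that every form of degree `2 * δ + 1` is in `B` up to a sum `∑ S, g_S ^ 2 * l_S`
(`InGeneralPosition.homogeneousSubmodule_le_sup`). Products of `δ` distinct `h_i` span the forms of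
degree `δ` (`InGeneralPosition.homogeneousSubmodule_le_span_prod`), so products `g_S * g_T * l` span
the forms of degree `2 * δ + 1`; for `S ≠ T` at most `δ - 1` of the `h_i` divide both `g_S` and
`g_T`, and the linear form `l` can be taken among the remaining ones, which keeps all exponents at
most `2`. A product of this kind with fewer than `δ + 2` distinct factors is some `g_S ^ 2 * h_i`.
-/

open Finset

/-! ### Linear forms -/

section LinearForms

variable {n : ℕ}

/-- The linear form attached to a coefficient vector, as a linear map. -/
noncomputable def linFormMap (n : ℕ) : (Fin (n + 1) → ℂ) →ₗ[ℂ] MvPolynomial (Fin (n + 1)) ℂ where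
  toFun := linForm
  map_add' c d := by simp [linForm, add_mul, sum_add_distrib]
  map_smul' a c := by simp [linForm, smul_eq_C_mul, mul_sum, mul_assoc]

@[simp]
theorem linFormMap_apply (c : Fin (n + 1) → ℂ) : linFormMap n c = linForm c := rfl

theorem eval_linForm (c v : Fin (n + 1) → ℂ) : eval v (linForm c) = c ⬝ᵥ v := by
  simp [linForm, dotProduct]

theorem pderiv_linForm (c : Fin (n + 1) → ℂ) (j : Fin (n + 1)) :
    pderiv j (linForm c) = C (c j) := by
  simp [linForm, pderiv_X, Pi.single_apply]

theorem isHomogeneous_linForm (c : Fin (n + 1) → ℂ) : (linForm c).IsHomogeneous 1 :=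
  IsHomogeneous.sum _ _ _ fun j _ => by
    simpa using (isHomogeneous_C _ (c j)).mul (isHomogeneous_X ℂ j)

theorem homogeneousSubmodule_one_le_range_linFormMap :
    homogeneousSubmodule (Fin (n + 1)) ℂ 1 ≤ LinearMap.range (linFormMap n) := by
  rw [homogeneousSubmodule_one_eq_span_X, Submodule.span_le]
  rintro _ ⟨j, rfl⟩
  exact ⟨Pi.single j 1, by simp [linForm, Pi.single_apply]⟩

/-- A polynomial divisible by a product of two polynomials vanishing at `P` is singular at `P`. -/
theorem singularAt_of_mul_dvd {f a b : MvPolynomial (Fin (n + 1)) ℂ} {P : ProjSpace n}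
    (hf : a * b ∣ f) (ha : eval P.rep a = 0) (hb : eval P.rep b = 0) : SingularAt f P := by
  obtain ⟨g, rfl⟩ := hf
  refine ⟨by simp [ha], fun j => by simp [Derivation.leibniz, ha, hb]⟩

/-- By Euler's identity, a form of positive degree is singular wherever its gradient vanishes. -/
theorem singularAt_iff_of_isHomogeneous {d : ℕ} {f : MvPolynomial (Fin (n + 1)) ℂ}
    (hd : d ≠ 0) (hf : f.IsHomogeneous d) {P : ProjSpace n} :
    SingularAt f P ↔ ∀ j, eval P.rep (pderiv j f) = 0 := by
  refine ⟨fun h => h.2, fun h => ⟨?_, h⟩⟩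
  have key := congrArg (eval P.rep) hf.sum_X_mul_pderiv
  simpa [h, hd] using key.symm

/-- If `g` does not vanish at `v`, then `c ↦ ∇(g ^ 2 * linForm c)(v)` is injective. -/
theorem eq_zero_of_pderiv_sq_mul_linForm {d : ℕ} {g : MvPolynomial (Fin (n + 1)) ℂ}
    {v c : Fin (n + 1) → ℂ} (hg : g.IsHomogeneous d) (hv : eval v g ≠ 0)
    (h : ∀ j, eval v (pderiv j (g ^ 2 * linForm c)) = 0) : c = 0 := by
  have hhom : (g ^ 2 * linForm c).IsHomogeneous (d * 2 + 1) :=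
    (hg.pow 2).mul (isHomogeneous_linForm c)
  -- Euler's identity shows that `linForm c` vanishes at `v`, so only the term `g ^ 2 * c` remains.
  have key := congrArg (eval v) hhom.sum_X_mul_pderiv
  have hc : eval v (linForm c) = 0 := by
    have : ((d : ℂ) * 2 + 1) ≠ 0 := by exact_mod_cast Nat.succ_ne_zero (d * 2)
    simp only [map_sum, map_mul, h, mul_zero, sum_const_zero] at key
    simpa [hv, this] using key.symm
  funext j
  simpa [Derivation.leibniz, hc, hv, pderiv_linForm] using h j

end LinearForms

/-! ### Hyperplanes in linearly general position -/

section GeneralPosition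

variable {n m : ℕ} {h : Fin m → Fin (n + 1) → ℂ}

theorem InGeneralPosition.span_eq_top (hh : InGeneralPosition h) {U : Finset (Fin m)}
    (hU : n + 1 ≤ U.card) : Submodule.span ℂ (h '' U) = ⊤ := by
  obtain ⟨S, hSU, hS⟩ := exists_subset_card_eq hU
  have := (hh S hS).span_eq_top_of_card_eq_finrank' (by simp [hS])
  rw [eq_top_iff, ← this]
  apply Submodule.span_mono
  rintro _ ⟨i, rfl⟩
  exact ⟨i, hSU i.2, rfl⟩

theorem InGeneralPosition.homogeneousSubmodule_one_le (hh : InGeneralPosition h)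
    {U : Finset (Fin m)} (hU : n + 1 ≤ U.card) :
    homogeneousSubmodule (Fin (n + 1)) ℂ 1 ≤
      Submodule.span ℂ ((fun i => linForm (h i)) '' U) := by
  refine homogeneousSubmodule_one_le_range_linFormMap.trans ?_
  rw [LinearMap.range_eq_map, ← hh.span_eq_top hU, Submodule.map_span, ← Set.image_comp]
  rfl

/-- A vector on `n + 1` hyperplanes in general position is zero. -/
theorem InGeneralPosition.eq_zero (hh : InGeneralPosition h) {U : Finset (Fin m)}
    (hU : n + 1 ≤ U.card) {v : Fin (n + 1) → ℂ} (hv : ∀ i ∈ U, h i ⬝ᵥ v = 0) : v = 0 := by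
  refine dotProduct_eq_zero v fun w => ?_
  have hw : w ∈ Submodule.span ℂ (h '' U) := hh.span_eq_top hU ▸ Submodule.mem_top
  rw [dotProduct_comm]
  induction hw using Submodule.span_induction with
  | mem x hx => obtain ⟨i, hi, rfl⟩ := hx; exact hv i hi
  | zero => simp
  | add x y _ _ hx hy => simp [add_dotProduct, hx, hy]
  | smul a x _ hx => simp [smul_dotProduct, hx]

/-- Linearly general position is the nonvanishing of the product of the maximal minors. -/
theorem exists_polynomial_ne_zero_iff_inGeneralPosition (n m : ℕ) :
    ∃ F : MvPolynomial (Fin m × Fin (n + 1)) ℂ, F ≠ 0 ∧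
      ∀ h : Fin m → Fin (n + 1) → ℂ, eval (fun p => h p.1 p.2) F ≠ 0 ↔ InGeneralPosition h := by
  let ι := {S : Finset (Fin m) // S.card = n + 1}
  let M (S : ι) : Matrix (Fin (n + 1)) (Fin (n + 1)) (MvPolynomial (Fin m × Fin (n + 1)) ℂ) :=
    Matrix.of fun a b => X (S.1.orderEmbOfFin S.2 a, b)
  have heval (S : ι) (x : Fin m × Fin (n + 1) → ℂ) : eval x (M S).det =
      (Matrix.of fun a b => x (S.1.orderEmbOfFin S.2 a, b)).det := by
    rw [RingHom.map_det]
    congr 1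
    ext a b
    simp [M]
  refine ⟨∏ S, (M S).det, prod_ne_zero_iff.2 fun S _ h0 => ?_, fun h => ?_⟩
  · have h1 := heval S fun p => if p.1 = S.1.orderEmbOfFin S.2 p.2 then 1 else 0
    have h2 : (Matrix.of fun a b => if S.1.orderEmbOfFin S.2 a = S.1.orderEmbOfFin S.2 b
        then (1 : ℂ) else 0) = 1 := by
      ext a b
      simp [Matrix.one_apply]
    simp only [h2] at h1
    simp [h0] at h1
  · rw [map_prod, prod_ne_zero_iff]
    refine ⟨fun H S hS => ?_, fun H S _ => ?_⟩
    · have h1 := H ⟨S, hS⟩ (mem_univ _)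
      rw [heval, ← isUnit_iff_ne_zero, ← Matrix.isUnit_iff_isUnit_det,
        ← Matrix.linearIndependent_rows_iff_isUnit] at h1
      exact (linearIndependent_equiv (S.orderIsoOfFin hS).toEquiv
        (f := fun i : S => h i)).1 h1
    · rw [heval, ← isUnit_iff_ne_zero, ← Matrix.isUnit_iff_isUnit_det,
        ← Matrix.linearIndependent_rows_iff_isUnit]
      exact (linearIndependent_equiv (S.1.orderIsoOfFin S.2).toEquiv
        (f := fun i : S.1 => h i)).2 (H S.1 S.2)

end GeneralPosition

/-! ### The points of the star configuration -/

section StarPoints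

variable {n m : ℕ} {h : Fin m → Fin (n + 1) → ℂ}

theorem exists_projSpace_eval_eq_zero (h : Fin m → Fin (n + 1) → ℂ) {S : Finset (Fin m)}
    (hS : S.card = n) : ∃ P : ProjSpace n, ∀ i ∈ S, eval P.rep (linForm (h i)) = 0 := by
  let L : (Fin (n + 1) → ℂ) →ₗ[ℂ] (S → ℂ) := Matrix.mulVecLin (Matrix.of fun i : S => h i)
  have hL : LinearMap.ker L ≠ ⊥ := LinearMap.ker_ne_bot_of_finrank_lt (by simp [hS])
  obtain ⟨v, hv, hv0⟩ := Submodule.exists_mem_ne_zero_of_ne_bot hL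
  refine ⟨Projectivization.mk ℂ v hv0, fun i hi => ?_⟩
  obtain ⟨a, ha⟩ := Projectivization.exists_smul_eq_mk_rep ℂ v hv0
  have h1 : h i ⬝ᵥ v = 0 := congrFun hv ⟨i, hi⟩
  rw [← ha, eval_linForm, dotProduct_smul, h1, smul_zero]

/-- A common point of `n` hyperplanes in general position. -/
noncomputable def starPoint (h : Fin m → Fin (n + 1) → ℂ)
    (S : {S : Finset (Fin m) // S.card = n}) : ProjSpace n :=
  (exists_projSpace_eval_eq_zero h S.2).choose

theorem eval_starPoint (S : {S : Finset (Fin m) // S.card = n}) {i : Fin m} (hi : i ∈ S.1) :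
    eval (starPoint h S).rep (linForm (h i)) = 0 :=
  (exists_projSpace_eval_eq_zero h S.2).choose_spec i hi

theorem InGeneralPosition.eval_starPoint_ne_zero (hh : InGeneralPosition h)
    (S : {S : Finset (Fin m) // S.card = n}) {i : Fin m} (hi : i ∉ S.1) :
    eval (starPoint h S).rep (linForm (h i)) ≠ 0 := fun h0 =>
  (starPoint h S).rep_nonzero <| hh.eq_zero (U := insert i S.1)
    (by rw [card_insert_of_notMem hi, S.2]) fun j hj => by
      rw [← eval_linForm]
      obtain rfl | hj := mem_insert.1 hj
      exacts [h0, eval_starPoint S hj]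

theorem InGeneralPosition.starPoint_injective (hh : InGeneralPosition h) :
    Function.Injective (starPoint h) := by
  intro S T hST
  refine Subtype.ext (eq_of_subset_of_card_le (fun i hi => ?_) (by rw [S.2, T.2]))
  by_contra hiT
  exact hh.eval_starPoint_ne_zero T hiT (hST ▸ eval_starPoint S hi)

/-- The points on at least `n` of the hyperplanes are exactly the points `starPoint h S`. -/
theorem InGeneralPosition.starPoints_eq_range (hh : InGeneralPosition h) (hm : n < m) :
    starPoints h = Set.range (starPoint h) := by
  ext P
  constructor
  · rintro ⟨S, hS, hP⟩
    obtain ⟨i, hi⟩ : ∃ i, i ∉ S := by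
      by_contra! hall
      have := card_le_card (fun i _ => hall i : (univ : Finset (Fin m)) ⊆ S)
      simp at this
      omega
    refine ⟨⟨S, hS⟩, ?_⟩
    set Q := starPoint h ⟨S, hS⟩
    have hQ : h i ⬝ᵥ Q.rep ≠ 0 := by
      rw [← eval_linForm]; exact hh.eval_starPoint_ne_zero ⟨S, hS⟩ hi
    -- The combination of the two representatives that lies on one more hyperplane is zero.
    have hz : (h i ⬝ᵥ P.rep) • Q.rep - (h i ⬝ᵥ Q.rep) • P.rep = 0 := by
      refine hh.eq_zero (U := insert i S) (by rw [card_insert_of_notMem hi, hS]) fun j hj => ?_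
      obtain rfl | hj := mem_insert.1 hj
      · simp only [dotProduct_sub, dotProduct_smul, smul_eq_mul]; ring
      · have h1 : h j ⬝ᵥ P.rep = 0 := by rw [← eval_linForm]; exact hP j hj
        have h2 : h j ⬝ᵥ Q.rep = 0 := by
          rw [← eval_linForm]; exact eval_starPoint (h := h) ⟨S, hS⟩ hj
        simp [dotProduct_sub, dotProduct_smul, h1, h2]
    rw [← Q.mk_rep, ← P.mk_rep, eq_comm, Projectivization.mk_eq_mk_iff']
    refine ⟨(h i ⬝ᵥ Q.rep)⁻¹ * (h i ⬝ᵥ P.rep), ?_⟩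
    rw [mul_smul, sub_eq_zero.1 hz, inv_smul_smul₀ hQ]
  · rintro ⟨S, rfl⟩
    exact ⟨S.1, S.2, fun i hi => eval_starPoint S hi⟩

theorem InGeneralPosition.ncard_starPoints (hh : InGeneralPosition h) (hm : n < m) :
    (starPoints h).ncard = m.choose n := by
  rw [hh.starPoints_eq_range hm, ← Set.image_univ, Set.ncard_image_of_injective _
    hh.starPoint_injective, Set.ncard_univ, Nat.card_eq_fintype_card, Fintype.card_finset_len,
    Fintype.card_fin]

end StarPoints

/-! ### Forms spanned by products of the linear forms -/

section Products

variable {n m : ℕ} {h : Fin m → Fin (n + 1) → ℂ}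

theorem span_mul_le_of_forall {R A : Type*} [CommSemiring R] [Semiring A] [Algebra R A]
    {s : Set A} {N M : Submodule R A}
    (H : ∀ a ∈ s, ∃ t : Set A, N ≤ Submodule.span R t ∧ ∀ b ∈ t, a * b ∈ M) :
    Submodule.span R s * N ≤ M := by
  rw [Submodule.mul_le]
  intro a ha b hb
  induction ha using Submodule.span_induction with
  | mem a ha =>
    obtain ⟨t, hN, ht⟩ := H a ha
    have : Submodule.span R t ≤ M.comap (LinearMap.mulLeft R a) := Submodule.span_le.2 ht
    exact this (hN hb)
  | zero => simp
  | add x y _ _ hx hy => simpa [add_mul] using add_mem hx hy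
  | smul r x _ hx => simpa using M.smul_mem r hx

/-- Forms of degree `d ≤ m - n` are spanned by the products of `d` distinct forms `linForm (h i)`:
at each step, the forms not yet used still span all linear forms. -/
theorem InGeneralPosition.homogeneousSubmodule_le_span_prod (hh : InGeneralPosition h) {d : ℕ}
    (hd : d + n ≤ m) : homogeneousSubmodule (Fin (n + 1)) ℂ d ≤
      Submodule.span ℂ {g | ∃ T : Finset (Fin m), T.card = d ∧ g = ∏ i ∈ T, linForm (h i)} := by
  induction d with
  | zero =>
    rw [homogeneousSubmodule_zero, Submodule.one_eq_span, Submodule.span_le,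
      Set.singleton_subset_iff]
    exact Submodule.subset_span ⟨∅, by simp⟩
  | succ d ih =>
    rw [← homogeneousSubmodule_one_pow, pow_succ, homogeneousSubmodule_one_pow]
    refine (mul_le_mul_left (ih (by omega)) _).trans (span_mul_le_of_forall ?_)
    rintro _ ⟨T, hT, rfl⟩
    refine ⟨_, hh.homogeneousSubmodule_one_le (U := Tᶜ) ?_, ?_⟩
    · rw [card_compl, Fintype.card_fin]; omega
    · rintro _ ⟨i, hi, rfl⟩
      have hi : i ∉ T := by simpa using hi
      exact Submodule.subset_span ⟨insert i T, by rw [card_insert_of_notMem hi, hT],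
        by rw [prod_insert hi, mul_comm]⟩

end Products

/-! ### Forms of degree `2 * δ + 1` -/

section DoublePoints

variable {n δ : ℕ} {h : Fin (δ + n) → Fin (n + 1) → ℂ}

/-- The products of degree `2 * δ + 1` of the forms `linForm (h i)`, with exponents at most `2`
and at least `δ + 2` distinct factors. -/
def manyFactorProducts (h : Fin (δ + n) → Fin (n + 1) → ℂ) : Set (MvPolynomial (Fin (n + 1)) ℂ) :=
  {g | ∃ k : Fin (δ + n) → ℕ, ∑ i, k i = 2 * δ + 1 ∧
    δ + 2 ≤ (univ.filter fun i => 0 < k i).card ∧ (∀ i, k i ≤ 2) ∧ g = formProduct h k}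

/-- The product of the `δ` linear forms that do not vanish at `starPoint h S`. -/
noncomputable def complProd (h : Fin (δ + n) → Fin (n + 1) → ℂ)
    (S : {S : Finset (Fin (δ + n)) // S.card = n}) : MvPolynomial (Fin (n + 1)) ℂ :=
  ∏ i ∈ S.1ᶜ, linForm (h i)

theorem isHomogeneous_complProd (S : {S : Finset (Fin (δ + n)) // S.card = n}) :
    (complProd h S).IsHomogeneous δ := by
  have := IsHomogeneous.prod S.1ᶜ (fun i => linForm (h i)) (fun _ => 1)
    fun i _ => isHomogeneous_linForm (h i)
  simpa [card_compl, S.2, complProd] using this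

theorem InGeneralPosition.eval_complProd_ne_zero (hh : InGeneralPosition h)
    (S : {S : Finset (Fin (δ + n)) // S.card = n}) :
    eval (starPoint h S).rep (complProd h S) ≠ 0 := by
  rw [complProd, map_prod, prod_ne_zero_iff]
  exact fun i hi => hh.eval_starPoint_ne_zero S (mem_compl.1 hi)

theorem eval_complProd_of_ne {S T : {S : Finset (Fin (δ + n)) // S.card = n}} (hST : S ≠ T) :
    eval (starPoint h T).rep (complProd h S) = 0 := by
  obtain ⟨i, hiT, hiS⟩ : ∃ i ∈ T.1, i ∉ S.1 := by
    by_contra! hall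
    exact hST (Subtype.ext (eq_of_subset_of_card_le hall (by rw [S.2, T.2])).symm)
  rw [complProd, map_prod]
  exact prod_eq_zero (mem_compl.2 hiS) (eval_starPoint T hiT)

/-- The form `∑ S, (complProd h S) ^ 2 * linForm (c S)`, as a linear function of `c`. The summand
of `S` is singular at all points `starPoint h T` with `T ≠ S`. -/
noncomputable def squareSum (h : Fin (δ + n) → Fin (n + 1) → ℂ) :
    ({S : Finset (Fin (δ + n)) // S.card = n} → Fin (n + 1) → ℂ) →ₗ[ℂ]
      homogeneousSubmodule (Fin (n + 1)) ℂ (2 * δ + 1) :=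
  LinearMap.codRestrict _
    (∑ S, LinearMap.mulLeft ℂ (complProd h S ^ 2) ∘ₗ linFormMap n ∘ₗ LinearMap.proj S) fun c => by
      rw [LinearMap.sum_apply]
      refine Submodule.sum_mem _ fun S _ => ?_
      rw [mul_comm 2]
      exact ((isHomogeneous_complProd S).pow 2).mul (isHomogeneous_linForm (c S))

theorem coe_squareSum (c : {S : Finset (Fin (δ + n)) // S.card = n} → Fin (n + 1) → ℂ) :
    (squareSum h c : MvPolynomial (Fin (n + 1)) ℂ) =
      ∑ S, complProd h S ^ 2 * linForm (c S) := by
  simp [squareSum, LinearMap.sum_apply]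

/-- The gradients of a form at all the points `starPoint h S`. -/
noncomputable def starGradient (h : Fin (δ + n) → Fin (n + 1) → ℂ) (d : ℕ) :
    homogeneousSubmodule (Fin (n + 1)) ℂ d →ₗ[ℂ]
      ({S : Finset (Fin (δ + n)) // S.card = n} → Fin (n + 1) → ℂ) :=
  LinearMap.pi fun S => LinearMap.pi fun j =>
    (aeval (R := ℂ) (starPoint h S).rep).toLinearMap ∘ₗ (pderiv j).toLinearMap ∘ₗ
      Submodule.subtype _

theorem starGradient_apply {d : ℕ} (f : homogeneousSubmodule (Fin (n + 1)) ℂ d)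
    (S : {S : Finset (Fin (δ + n)) // S.card = n}) (j : Fin (n + 1)) :
    starGradient h d f S j = eval (starPoint h S).rep (pderiv j f.1) := by
  simp [starGradient, aeval_eq_eval]

theorem InGeneralPosition.ker_starGradient (hh : InGeneralPosition h) (hδ : 1 ≤ δ) {d : ℕ}
    (hd : d ≠ 0) : LinearMap.ker (starGradient h d) = singularSystem d (starPoints h) := by
  ext f
  rw [hh.starPoints_eq_range (by omega), LinearMap.mem_ker]
  change _ ↔ ∀ P ∈ Set.range (starPoint h), SingularAt f.1 P
  rw [Set.forall_mem_range]
  simp [singularAt_iff_of_isHomogeneous hd f.2, funext_iff, starGradient_apply]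

/-- At `starPoint h S` only the summand of `S` contributes to the gradient of a square sum. -/
theorem starGradient_squareSum (c : {S : Finset (Fin (δ + n)) // S.card = n} → Fin (n + 1) → ℂ)
    (S : {S : Finset (Fin (δ + n)) // S.card = n}) (j : Fin (n + 1)) :
    starGradient h _ (squareSum h c) S j =
      eval (starPoint h S).rep (pderiv j (complProd h S ^ 2 * linForm (c S))) := by
  rw [starGradient_apply, coe_squareSum, map_sum, map_sum]
  refine sum_eq_single_of_mem S (mem_univ S) fun T _ hT => ?_
  refine (singularAt_of_mul_dvd ?_ (eval_complProd_of_ne hT) (eval_complProd_of_ne hT)).2 j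
  exact ⟨linForm (c T), by ring⟩

theorem InGeneralPosition.starGradient_comp_squareSum_injective (hh : InGeneralPosition h) :
    Function.Injective (starGradient h _ ∘ₗ squareSum h) := by
  rw [injective_iff_map_eq_zero]
  intro c hc
  funext S
  refine eq_zero_of_pderiv_sq_mul_linForm (isHomogeneous_complProd S)
    (hh.eval_complProd_ne_zero S) fun j => ?_
  rw [← starGradient_squareSum]
  exact congrFun (congrFun hc S) j

theorem InGeneralPosition.starGradient_surjective (hh : InGeneralPosition h) :
    Function.Surjective (starGradient h (2 * δ + 1)) := by
  have := LinearMap.injective_iff_surjective.1 hh.starGradient_comp_squareSum_injective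
  rw [LinearMap.coe_comp] at this
  exact this.of_comp

theorem InGeneralPosition.finrank_quotient_singularSystem (hh : InGeneralPosition h)
    (hδ : 1 ≤ δ) :
    Module.finrank ℂ (homogeneousSubmodule (Fin (n + 1)) ℂ (2 * δ + 1) ⧸
      singularSystem (2 * δ + 1) (starPoints h)) = (n + 1) * (δ + n).choose n := by
  rw [← hh.ker_starGradient hδ (by omega),
    ((starGradient h (2 * δ + 1)).quotKerEquivOfSurjective hh.starGradient_surjective).finrank_eq,
    Module.finrank_pi_fintype]
  simp [mul_comm]

/-- A product with at least `δ + 2` distinct linear factors has two of them vanishing at each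
`starPoint h S`, because only `δ` of the linear forms do not vanish there. -/
theorem singularAt_of_mem_manyFactorProducts {g : MvPolynomial (Fin (n + 1)) ℂ}
    (hg : g ∈ manyFactorProducts h) (S : {S : Finset (Fin (δ + n)) // S.card = n}) :
    SingularAt g (starPoint h S) := by
  obtain ⟨k, hsum, hcard, hk, rfl⟩ := hg
  have hS : S.1ᶜ.card = δ := by simp [card_compl, S.2]
  have h2 : 1 < (S.1.filter fun i => 0 < k i).card := by
    have hsub : (univ.filter fun i => 0 < k i) ⊆ (S.1.filter fun i => 0 < k i) ∪ S.1ᶜ := by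
      intro i
      simp only [mem_filter, mem_union, mem_compl, mem_univ, true_and]
      tauto
    have := (card_le_card hsub).trans (card_union_le _ _)
    omega
  obtain ⟨i, hi, j, hj, hij⟩ := one_lt_card.1 h2
  rw [mem_filter] at hi hj
  refine singularAt_of_mul_dvd ?_ (eval_starPoint S hi.1) (eval_starPoint S hj.1)
  rw [formProduct, ← prod_erase_mul univ _ (mem_univ i), mul_comm]
  have hj' : j ∈ univ.erase i := mem_erase.2 ⟨hij.symm, mem_univ j⟩
  exact mul_dvd_mul ((dvd_pow_self _ hj.2.ne').trans
    (dvd_prod_of_mem (fun i => linForm (h i) ^ k i) hj')) (dvd_pow_self _ hi.2.ne')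

theorem isHomogeneous_of_mem_manyFactorProducts {g : MvPolynomial (Fin (n + 1)) ℂ}
    (hg : g ∈ manyFactorProducts h) : g.IsHomogeneous (2 * δ + 1) := by
  obtain ⟨k, hsum, -, -, rfl⟩ := hg
  rw [← hsum]
  refine IsHomogeneous.prod _ _ _ fun i _ => ?_
  simpa using (isHomogeneous_linForm (h i)).pow (k i)

theorem sq_prod_mul_linForm_mem {T : Finset (Fin (δ + n))} (hT : T.card = δ)
    (c : Fin (n + 1) → ℂ) : (∏ i ∈ T, linForm (h i)) ^ 2 * linForm c ∈
      (LinearMap.range (squareSum h)).map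
        (homogeneousSubmodule (Fin (n + 1)) ℂ (2 * δ + 1)).subtype := by
  have hTc : Tᶜ.card = n := by rw [card_compl, Fintype.card_fin]; omega
  refine ⟨_, ⟨Pi.single ⟨Tᶜ, hTc⟩ c, rfl⟩, ?_⟩
  rw [Submodule.subtype_apply, coe_squareSum,
    sum_eq_single_of_mem ⟨Tᶜ, hTc⟩ (mem_univ _) fun S _ hS => ?_]
  · simp [complProd]
  · rw [Pi.single_eq_of_ne hS, ← linFormMap_apply, map_zero, mul_zero]

theorem prod_mul_prod_mul_mem_manyFactorProducts {T T' : Finset (Fin (δ + n))} (hT : T.card = δ)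
    (hT' : T'.card = δ) {i : Fin (δ + n)} (hi : i ∈ T → i ∉ T')
    (hcard : δ + 2 ≤ (insert i (T ∪ T')).card) :
    (∏ i ∈ T, linForm (h i)) * (∏ i ∈ T', linForm (h i)) * linForm (h i) ∈
      manyFactorProducts h := by
  refine ⟨fun x => (if x ∈ T then 1 else 0) + (if x ∈ T' then 1 else 0) + if x = i then 1 else 0,
    ?_, ?_, fun x => ?_, ?_⟩
  · simp [sum_add_distrib, hT, hT', two_mul]
  · convert hcard using 2
    ext x
    simp only [mem_filter, mem_univ, true_and, mem_insert, mem_union]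
    split_ifs <;> simp_all
  · dsimp only
    by_cases hx : x = i
    · subst hx
      split_ifs <;> simp_all
    · split_ifs <;> simp
  · simp only [formProduct, pow_add, prod_mul_distrib, pow_ite, pow_one, pow_zero, prod_ite_mem,
      univ_inter, prod_ite_eq', mem_univ, if_true]

/-- If `T` and `T'` differ in a single element and `i ∈ T`, `i ∉ T'`, then `T' ∪ {i} = T ∪ {j}`
for the element `j` of `T'` not in `T`, and the product below is a square times a linear form. -/
theorem prod_mul_prod_mul_mem_of_card_union_le {T T' : Finset (Fin (δ + n))} (hT : T.card = δ)
    (hT' : T'.card = δ) {i : Fin (δ + n)} (hi : i ∈ T) (hi' : i ∉ T')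
    (hcard : (T ∪ T').card ≤ δ + 1) :
    (∏ i ∈ T, linForm (h i)) * (∏ i ∈ T', linForm (h i)) * linForm (h i) ∈
      (LinearMap.range (squareSum h)).map
        (homogeneousSubmodule (Fin (n + 1)) ℂ (2 * δ + 1)).subtype := by
  obtain ⟨j, hj, hjT⟩ : ∃ j ∈ T', j ∉ T := by
    by_contra! hall
    exact hi' (eq_of_subset_of_card_le hall (by omega) ▸ hi)
  have hins : insert i T' = insert j T := by
    have h1 : insert i T' = T ∪ T' := eq_of_subset_of_card_le
      (insert_subset (mem_union_left _ hi) subset_union_right)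
      (by rw [card_insert_of_notMem hi']; omega)
    have h2 : insert j T = T ∪ T' := eq_of_subset_of_card_le
      (insert_subset (mem_union_right _ hj) subset_union_left)
      (by rw [card_insert_of_notMem hjT]; omega)
    rw [h1, h2]
  have hprod := congrArg (fun U => ∏ x ∈ U, linForm (h x)) hins
  simp only [prod_insert hi', prod_insert hjT] at hprod
  rw [mul_assoc, mul_comm (∏ i ∈ T', _), hprod,
    show (∏ i ∈ T, linForm (h i)) * (linForm (h j) * ∏ i ∈ T, linForm (h i)) =
      (∏ i ∈ T, linForm (h i)) ^ 2 * linForm (h j) by ring]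
  exact sq_prod_mul_linForm_mem hT _

/-- Every form of degree `2 * δ + 1` is the sum of an element of `span (manyFactorProducts h)` and a
square sum. Such forms are spanned by `g * g' * l` with `g`, `g'` products of `δ` distinct forms
`linForm (h i)` and `l` linear. If `g = g'` this is a square sum; otherwise at least `n + 1` of the
forms `linForm (h i)` are not common to `g` and `g'`, and `l` may be chosen among them. The
resulting product has all exponents at most `2`, so it is a many-factor product unless it has just
`δ + 1` distinct factors, in which case `δ` of them are squared. -/
theorem InGeneralPosition.homogeneousSubmodule_le_sup (hh : InGeneralPosition h) :
    homogeneousSubmodule (Fin (n + 1)) ℂ (2 * δ + 1) ≤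
      Submodule.span ℂ (manyFactorProducts h) ⊔
        (LinearMap.range (squareSum h)).map
          (homogeneousSubmodule (Fin (n + 1)) ℂ (2 * δ + 1)).subtype := by
  have hfac : homogeneousSubmodule (Fin (n + 1)) ℂ (2 * δ + 1) =
      homogeneousSubmodule _ ℂ δ * homogeneousSubmodule _ ℂ δ * homogeneousSubmodule _ ℂ 1 := by
    rw [← homogeneousSubmodule_one_pow, pow_succ, two_mul, pow_add, homogeneousSubmodule_one_pow]
  refine hfac.le.trans ?_
  have hV := hh.homogeneousSubmodule_le_span_prod le_rfl
  refine (mul_le_mul_left (mul_le_mul' hV hV) _).trans ?_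
  rw [Submodule.span_mul_span]
  refine span_mul_le_of_forall ?_
  rintro _ ⟨_, ⟨T, hT, rfl⟩, _, ⟨T', hT', rfl⟩, rfl⟩
  dsimp only
  obtain rfl | hne := eq_or_ne T T'
  · refine ⟨Set.range (linFormMap n), ?_, ?_⟩
    · exact homogeneousSubmodule_one_le_range_linFormMap.trans Submodule.subset_span
    · rintro _ ⟨c, rfl⟩
      simpa [sq] using Submodule.mem_sup_right (sq_prod_mul_linForm_mem (h := h) hT c)
  · have hinter : (T ∩ T').card < δ := by
      by_contra! hle
      have h1 := eq_of_subset_of_card_le (inter_subset_left (s₁ := T) (s₂ := T')) (by omega)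
      have h2 := eq_of_subset_of_card_le (inter_subset_right (s₁ := T) (s₂ := T')) (by omega)
      exact hne (h1.symm.trans h2)
    refine ⟨_, hh.homogeneousSubmodule_one_le (U := (T ∩ T')ᶜ) ?_, ?_⟩
    · rw [card_compl, Fintype.card_fin]; omega
    rintro _ ⟨i, hi, rfl⟩
    have hi : i ∈ T → i ∉ T' := by simpa [imp_iff_not_or] using hi
    by_cases hsupp : δ + 2 ≤ (insert i (T ∪ T')).card
    · exact Submodule.mem_sup_left <| Submodule.subset_span <|
        prod_mul_prod_mul_mem_manyFactorProducts hT hT' hi hsupp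
    · refine Submodule.mem_sup_right ?_
      have h1 : δ + 1 ≤ (T ∪ T').card := by have := card_union_add_card_inter T T'; omega
      have h2 : i ∈ T ∪ T' := by
        by_contra hni
        rw [card_insert_of_notMem hni] at hsupp
        omega
      rw [insert_eq_self.2 h2] at hsupp
      by_cases hiT : i ∈ T
      · exact prod_mul_prod_mul_mem_of_card_union_le hT hT' hiT (hi hiT) (by omega)
      · have hiT' : i ∈ T' := (mem_union.1 h2).resolve_left hiT
        rw [mul_comm (∏ i ∈ T, _)]
        exact prod_mul_prod_mul_mem_of_card_union_le hT' hT hiT' hiT (by rw [union_comm]; omega)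

theorem InGeneralPosition.map_singularSystem_eq (hh : InGeneralPosition h) (hδ : 1 ≤ δ) :
    (singularSystem (2 * δ + 1) (starPoints h)).map
      (homogeneousSubmodule (Fin (n + 1)) ℂ (2 * δ + 1)).subtype =
      Submodule.span ℂ (manyFactorProducts h) := by
  have hle : Submodule.span ℂ (manyFactorProducts h) ≤
      (singularSystem (2 * δ + 1) (starPoints h)).map
        (homogeneousSubmodule (Fin (n + 1)) ℂ (2 * δ + 1)).subtype := by
    refine Submodule.span_le.2 fun g hg =>
      ⟨⟨g, isHomogeneous_of_mem_manyFactorProducts hg⟩, ?_, rfl⟩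
    change ∀ P ∈ starPoints h, SingularAt g P
    rw [hh.starPoints_eq_range (by omega), Set.forall_mem_range]
    exact singularAt_of_mem_manyFactorProducts hg
  refine le_antisymm ?_ hle
  rintro _ ⟨f, hf, rfl⟩
  obtain ⟨b, hb, _, ⟨_, ⟨c, rfl⟩, rfl⟩, hbw⟩ :=
    Submodule.mem_sup.1 (hh.homogeneousSubmodule_le_sup f.2)
  obtain ⟨b, hb', rfl⟩ := hle hb
  -- The square sum is itself singular at the star points, which forces its coefficients to vanish.
  have hf' : b + squareSum h c = f := Subtype.ext hbw
  rw [SetLike.mem_coe, ← hh.ker_starGradient hδ (by omega), LinearMap.mem_ker] at hf hb'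
  rw [← hf', map_add, hb', zero_add] at hf
  have hc : c = 0 := hh.starGradient_comp_squareSum_injective (by simpa using hf)
  rw [hc, map_zero, add_zero] at hf'
  rwa [← hf']

end DoublePoints

/-! ### The expected codimension -/

theorem succ_mul_choose_le_choose (n δ : ℕ) :
    (n + 1) * (δ + n).choose n ≤ (n + (2 * δ + 1)).choose n := by
  induction n with
  | zero => simp
  | succ n ih =>
    have h1 := Nat.add_one_mul_choose_eq (δ + n) n
    have h2 := Nat.add_one_mul_choose_eq (n + (2 * δ + 1)) n
    rw [show δ + (n + 1) = δ + n + 1 by ring,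
      show n + 1 + (2 * δ + 1) = n + (2 * δ + 1) + 1 by ring]
    -- The right side grows at least as fast with `n` as the left side, because
    -- `(n + 2) (δ + n + 1) ≤ (n + 1) (n + 2 δ + 2)`.
    refine Nat.le_of_mul_le_mul_left (c := n + 1) ?_ n.succ_pos
    have h3 : (n + 2) * (δ + n + 1) ≤ (n + 1) * (n + (2 * δ + 1) + 1) := by nlinarith
    calc (n + 1) * ((n + 1 + 1) * (δ + n + 1).choose (n + 1))
        = (n + 2) * ((δ + n + 1).choose (n + 1) * (n + 1)) := by ring
      _ = (n + 2) * (δ + n + 1) * (δ + n).choose n := by rw [← h1]; ring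
      _ ≤ (n + 1) * (n + (2 * δ + 1) + 1) * (δ + n).choose n := Nat.mul_le_mul_right _ h3
      _ = (n + (2 * δ + 1) + 1) * ((n + 1) * (δ + n).choose n) := by ring
      _ ≤ (n + (2 * δ + 1) + 1) * (n + (2 * δ + 1)).choose n := Nat.mul_le_mul_left _ ih
      _ = (n + 1) * (n + (2 * δ + 1) + 1).choose (n + 1) := by rw [h2]; ring

theorem corollary7p6 (n δ : ℕ) (hδ : 1 ≤ δ) :
    -- linearly general position is a nonempty Zariski-open condition on the hyperplanes
    (∃ F : MvPolynomial (Fin (δ + n) × Fin (n + 1)) ℂ, F ≠ 0 ∧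
      ∀ h : Fin (δ + n) → Fin (n + 1) → ℂ,
        eval (fun p => h p.1 p.2) F ≠ 0 ↔ InGeneralPosition h) ∧
    -- and it suffices for the conclusion
    ∀ h : Fin (δ + n) → Fin (n + 1) → ℂ, InGeneralPosition h →
      (starPoints h).ncard = (δ + n).choose n ∧
      Module.finrank ℂ (homogeneousSubmodule (Fin (n + 1)) ℂ (2 * δ + 1) ⧸
          singularSystem (2 * δ + 1) (starPoints h)) =
        expectedCodim n (2 * δ + 1) 0 (starPoints h).ncard ∧
      expectedCodim n (2 * δ + 1) 0 (starPoints h).ncard = (n + 1) * (δ + n).choose n ∧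
      (singularSystem (2 * δ + 1) (starPoints h)).map
          (homogeneousSubmodule (Fin (n + 1)) ℂ (2 * δ + 1)).subtype =
        Submodule.span ℂ
          {g | ∃ k : Fin (δ + n) → ℕ, ∑ i, k i = 2 * δ + 1 ∧
            δ + 2 ≤ (Finset.univ.filter fun i => 0 < k i).card ∧ (∀ i, k i ≤ 2) ∧
            g = formProduct h k} := by
  refine ⟨exists_polynomial_ne_zero_iff_inGeneralPosition n (δ + n), fun h hh => ?_⟩
  have hcard := hh.ncard_starPoints (by omega)
  have hexp : expectedCodim n (2 * δ + 1) 0 (starPoints h).ncard =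
      (n + 1) * (δ + n).choose n := by
    rw [expectedCodim, hcard, zero_add, mul_comm (Nat.choose _ _),
      min_eq_right (succ_mul_choose_le_choose n δ)]
  exact ⟨hcard, (hh.finrank_quotient_singularSystem hδ).trans hexp.symm, hexp,
    hh.map_singularSystem_eq hδ⟩
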